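/- Let $X$ be a real Banach space and $m$ a positive integer. For a bounded set $A\subset X$ with diameter $\delta(A)=\sup\{\|x-y\| : x,y\in A\}>0$ put $$\beta_X(A,m)=\inf\left\{\frac{1}{\delta(A)}\max_{1\le k\le m}\delta(A_k)\ :\ A=\bigcup_{k=1}^m A_k\right\},$$ and put $$\beta(X,m)=\sup\{\beta_X(A,m)\ :\ A\subset X \text{ bounded},\ \delta(A)>0\}.$$ (Here the diameter of the empty set is $0$.) Let $B_X$ be the closed unit ball of $X$. If $X$ is a $3$-dimensional real Banach space with $\beta_X(B_X,8)<\frac{221}{328}$, then $\beta(X,8)<1$. Moreover, for $l_1^3=(\mathbb{R}^3,\|\cdot\|_1)$ with $\|x\|_1=|x_1|+|x_2|+|x_3|$, one has $\beta(l_1^3,8)<1$. -/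

import Mathlib

/-- `β_X(A, m)`: the infimum, over all representations of `A` as a union of `m` sets
`A_1, …, A_m`, of `(1 / diam A) * max_k diam A_k`. It is used for bounded sets `A` with
`0 < diam A` and for `m ≥ 1`; the maximum over `Fin m` is written as a (finite) supremum,
and an empty piece has diameter `0`. -/
noncomputable def betaSet {X : Type*} [NormedAddCommGroup X] (A : Set X) (m : ℕ) : ℝ :=
  sInf {r : ℝ | ∃ S : Fin m → Set X,
    A = ⋃ k, S k ∧ r = 1 / Metric.diam A * ⨆ k, Metric.diam (S k)}

/-- `β(X, m)`: the supremum of `β_X(A, m)` over all bounded sets `A` in `X` of positive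
diameter. -/
noncomputable def betaSpace (X : Type*) [NormedAddCommGroup X] (m : ℕ) : ℝ :=
  sSup {b : ℝ | ∃ A : Set X,
    Bornology.IsBounded A ∧ 0 < Metric.diam A ∧ b = betaSet A m}

/-- The infimum defining `β_X(A, m)` is over a set bounded below. -/
theorem betaSet_bddBelow {X : Type*} [NormedAddCommGroup X] (A : Set X) (m : ℕ) :
    BddBelow {r : ℝ | ∃ S : Fin m → Set X,
      A = ⋃ k, S k ∧ r = 1 / Metric.diam A * ⨆ k, Metric.diam (S k)} := by
  refine ⟨0, ?_⟩
  rintro r ⟨S, -, rfl⟩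
  exact mul_nonneg (one_div_nonneg.mpr Metric.diam_nonneg)
    (Real.iSup_nonneg fun _ => Metric.diam_nonneg)

/-- `β_X(A, m) ≤ 1` for positive `m`: take every piece equal to `A`. -/
theorem betaSet_le_one {X : Type*} [NormedAddCommGroup X] (A : Set X) (m : ℕ) (hm : 0 < m) :
    betaSet A m ≤ 1 := by
  have : Nonempty (Fin m) := ⟨⟨0, hm⟩⟩
  refine (csInf_le (betaSet_bddBelow A m)
    ⟨fun _ => A, (Set.iUnion_const A).symm, rfl⟩).trans ?_
  rw [ciSup_const, one_div]
  exact inv_mul_le_one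

/-- The supremum defining `β(X, m)` is over a set bounded above, so it is a true supremum. -/
theorem betaSpace_bddAbove (X : Type*) [NormedAddCommGroup X] (m : ℕ) (hm : 0 < m) :
    BddAbove {b : ℝ | ∃ A : Set X,
      Bornology.IsBounded A ∧ 0 < Metric.diam A ∧ b = betaSet A m} := by
  refine ⟨1, ?_⟩
  rintro b ⟨A, -, -, rfl⟩
  exact betaSet_le_one A m hm

/-! Put `R = 164 / 221`, so that `221 / 328 = 1 / (2 * R)`. If `A` lies in a ball of radius `R *
diam A`, a good partition of the unit ball, rescaled, splits `A`
(`betaSet_le_of_subset_closedBall`). Otherwise Helly gives four points `x i` of `A` in no common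
ball of that radius, and Hahn–Banach gives functionals `g i` with sum zero, total norm one and `∑ g
i (x i) > R * δ`. The slacks `‖g i‖ * δ - g i (x i - y)` are affine in `y`, nonnegative on `A` and
of constant sum; normalised, they act as barycentric coordinates on `A`, nearly a unit vector at
each `x i`. Bounding one coordinate below by `1 / 4` gives four pieces covering `A`. Inverting the
near-identity coordinate matrix in `ℓ¹` bounds their diameters. -/

open scoped Pointwise in
/-- If no closed ball of radius `r` contains the points `x i`, then there are functionals `g i` of
total norm one, with sum zero, and with `∑ i, g i (x i) > r`. -/
theorem exists_dual_certificate_of_no_common_ball {ι X : Type*} [Fintype ι]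
    [NormedAddCommGroup X] [NormedSpace ℝ X] [FiniteDimensional ℝ X] (x : ι → X) {r : ℝ}
    (hr : 0 ≤ r) (hx : ∀ c : X, ∃ i, r < dist (x i) c) :
    ∃ g : ι → StrongDual ℝ X, ∑ i, g i = 0 ∧ ∑ i, ‖g i‖ = 1 ∧ r < ∑ i, g i (x i) := by
  classical
  have : ProperSpace X := FiniteDimensional.proper_real X
  -- The diagonal plus the sup-norm ball of radius `r` is the set of tuples lying in a common ball
  -- of radius `r`.
  let D : Submodule ℝ (ι → X) := LinearMap.range (LinearMap.pi fun _ : ι => LinearMap.id (R := ℝ) (M := X))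
  have hD : ∀ c : X, (fun _ => c) ∈ D := fun c => ⟨c, rfl⟩
  have hS : IsClosed ((D : Set (ι → X)) + Metric.closedBall (0 : ι → X) r) :=
    D.closed_of_finiteDimensional.add_right_of_isCompact (isCompact_closedBall _ _)
  have hxS : x ∉ (D : Set (ι → X)) + Metric.closedBall (0 : ι → X) r := by
    rintro ⟨_, ⟨c, rfl⟩, b, hb, rfl⟩
    obtain ⟨i, hi⟩ := hx c
    rw [mem_closedBall_zero_iff] at hb
    have : dist (((fun _ => c) + b : ι → X) i) c = ‖b i‖ := by simp [dist_eq_norm]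
    exact absurd ((norm_le_pi_norm b i).trans hb) (not_le.2 (this ▸ hi))
  obtain ⟨f, u, hf, hu⟩ := geometric_hahn_banach_closed_point
    (D.convex.add (convex_closedBall _ _)) hS hxS
  have hfD : ∀ c : X, f (fun _ => c) = 0 := by
    intro c
    by_contra h
    -- A functional bounded above on a subspace vanishes there; this multiple would take the
    -- excluded value `u`.
    have h1 := hf _ (Set.add_mem_add (D.smul_mem (u / f (fun _ => c)) (hD c))
      (Metric.mem_closedBall_self hr))
    simp [h] at h1
  let g : ι → StrongDual ℝ X := fun i => f.comp (ContinuousLinearMap.single ℝ (fun _ : ι => X) i)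
  have hfg : ∀ z : ι → X, f z = ∑ i, g i (z i) := by
    intro z
    conv_lhs => rw [← Finset.univ_sum_single z]
    rw [map_sum]
    rfl
  have hatt : ∀ i, ∃ b : X, ‖b‖ ≤ 1 ∧ g i b = ‖g i‖ := by
    intro i
    obtain ⟨b, hb, hmax⟩ := (isCompact_closedBall (0 : X) 1).exists_isMaxOn
      ⟨0, by simp⟩ (g i).continuous.continuousOn
    rw [mem_closedBall_zero_iff] at hb
    refine ⟨b, hb, le_antisymm ((le_abs_self _).trans ?_) ?_⟩
    · simpa using (g i).le_opNorm_of_le hb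
    · have h0 : 0 ≤ g i b := by simpa using hmax (show (0 : X) ∈ Metric.closedBall 0 1 by simp)
      refine (g i).opNorm_le_of_unit_norm h0 fun z hz => abs_le.2 ⟨?_, ?_⟩
      · have : g i (-z) ≤ g i b := hmax (by simp [hz])
        rw [map_neg] at this
        linarith
      · exact hmax (by simp [hz])
  choose b hb hgb using hatt
  have hrb : r * ∑ i, ‖g i‖ < u := by
    have h1 := hf _ (Set.add_mem_add D.zero_mem (show r • b ∈ Metric.closedBall (0 : ι → X) r by
      rw [mem_closedBall_zero_iff, norm_smul, Real.norm_of_nonneg hr]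
      exact mul_le_of_le_one_right hr ((pi_norm_le_iff_of_nonneg zero_le_one).2 hb)))
    simpa [hfg, hgb, Finset.mul_sum] using h1
  have hsum : ∑ i, g i = 0 := by
    ext c
    simpa [hfg] using hfD c
  have hL : 0 < ∑ i, ‖g i‖ := by
    refine (Finset.sum_nonneg fun i _ => norm_nonneg (g i)).lt_of_ne fun h => ?_
    have h0 := (Finset.sum_eq_zero_iff_of_nonneg fun i _ => norm_nonneg (g i)).1 h.symm
    have : f x = 0 := by
      rw [hfg]
      exact Finset.sum_eq_zero fun i hi => by simp [norm_eq_zero.1 (h0 i hi)]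
    rw [← h, mul_zero] at hrb
    linarith
  refine ⟨fun i => (∑ i, ‖g i‖)⁻¹ • g i, ?_, ?_, ?_⟩
  · rw [← Finset.smul_sum, hsum, smul_zero]
  · simp only [norm_smul, norm_inv, Real.norm_of_nonneg hL.le]
    rw [← Finset.mul_sum, inv_mul_cancel₀ hL.ne']
  · simp only [FunLike.coe_smul, Pi.smul_apply, smul_eq_mul]
    rw [← Finset.mul_sum, ← hfg, inv_mul_eq_div, lt_div_iff₀ hL]
    exact hrb.trans hu

/-! ### Estimates for near-barycentric coordinates -/

/-- A combination with total weight zero of points at mutual distance at most `δ` has norm at most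
`δ / 2` times the `ℓ¹`-norm of its weights. -/
theorem norm_sum_smul_le_of_sum_eq_zero {ι X : Type*} [Fintype ι] [Nonempty ι]
    [NormedAddCommGroup X] [NormedSpace ℝ X] (x : ι → X) {δ : ℝ}
    (hx : ∀ i j, dist (x i) (x j) ≤ δ) (c : ι → ℝ) (hc : ∑ i, c i = 0) :
    ‖∑ i, c i • x i‖ ≤ δ / 2 * ∑ i, |c i| := by
  obtain ⟨f, hf, hfv⟩ := exists_dual_vector'' ℝ (∑ i, c i • x i)
  obtain ⟨k, hk⟩ := Finite.exists_min fun i => f (x i)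
  -- Zero total weight permits recentring `f`, which gains the factor `1 / 2`.
  have h1 : ∀ i, |f (x i) - (f (x k) + δ / 2)| ≤ δ / 2 := by
    intro i
    have h2 : f (x i - x k) ≤ δ := (le_abs_self _).trans <|
      (f.le_of_opNorm_le hf _).trans (by simpa [dist_eq_norm] using hx i k)
    rw [map_sub] at h2
    have := hk i
    rw [abs_le]
    constructor <;> linarith
  have h3 : ‖∑ i, c i • x i‖ = ∑ i, c i * (f (x i) - (f (x k) + δ / 2)) := by
    simp only [mul_sub, Finset.sum_sub_distrib, ← Finset.sum_mul, hc, zero_mul, sub_zero]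
    simpa using hfv.symm
  rw [h3, Finset.mul_sum]
  refine Finset.sum_le_sum fun i _ => (le_abs_self _).trans ?_
  rw [abs_mul, mul_comm]
  exact mul_le_mul_of_nonneg_right (h1 i) (abs_nonneg _)

/-- A row-stochastic matrix with diagonal entries at least `t` expands the `ℓ¹`-norm by a factor of
at least `2 t - 1`. -/
theorem sum_abs_le_sum_abs_vecMul {ι : Type*} [Fintype ι] (M : ι → ι → ℝ) {t : ℝ}
    (h0 : ∀ i j, 0 ≤ M i j) (h1 : ∀ i, ∑ j, M i j = 1) (ht : ∀ i, t ≤ M i i) (c : ι → ℝ) :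
    (2 * t - 1) * ∑ i, |c i| ≤ ∑ j, |∑ i, c i * M i j| := by
  classical
  have h2 : ∀ j, 2 * (|c j| * M j j) - ∑ i, |c i| * M i j ≤ |∑ i, c i * M i j| := by
    intro j
    rw [← Finset.add_sum_erase _ _ (Finset.mem_univ j),
      ← Finset.add_sum_erase _ (fun i => c i * M i j) (Finset.mem_univ j)]
    have h3 := Finset.abs_sum_le_sum_abs (fun i => c i * M i j) (Finset.univ.erase j)
    have h4 : ∀ i, |c i * M i j| = |c i| * M i j := fun i => by
      rw [abs_mul, abs_of_nonneg (h0 i j)]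
    simp only [h4] at h3
    have h5 := abs_sub_abs_le_abs_add (c j * M j j) (∑ i ∈ Finset.univ.erase j, c i * M i j)
    rw [h4] at h5
    linarith
  calc (2 * t - 1) * ∑ i, |c i|
      ≤ ∑ i, (2 * (|c i| * M i i) - |c i|) := by
        rw [Finset.mul_sum]
        refine Finset.sum_le_sum fun i _ => ?_
        nlinarith [mul_le_mul_of_nonneg_left (ht i) (abs_nonneg (c i))]
    _ = ∑ j, (2 * (|c j| * M j j) - ∑ i, |c i| * M i j) := by
        rw [Finset.sum_sub_distrib, Finset.sum_sub_distrib, Finset.sum_comm]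
        simp only [← Finset.mul_sum, h1, mul_one]
    _ ≤ _ := Finset.sum_le_sum fun j _ => h2 j

/-- Two stochastic vectors that both have `k`-th entry at least `s` are at `ℓ¹`-distance at most
`2 (1 - s)`. -/
theorem sum_abs_sub_le_of_le_apply {ι : Type*} [Fintype ι] (p q : ι → ℝ) (hp : ∀ i, 0 ≤ p i)
    (hq : ∀ i, 0 ≤ q i) (hp1 : ∑ i, p i = 1) (hq1 : ∑ i, q i = 1) {k : ι} {s : ℝ}
    (hpk : s ≤ p k) (hqk : s ≤ q k) : ∑ i, |p i - q i| ≤ 2 * (1 - s) := by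
  have h1 : ∀ i, |p i - q i| = p i + q i - 2 * min (p i) (q i) := fun i => by
    rcases le_total (p i) (q i) with h | h
    · rw [min_eq_left h, abs_of_nonpos (by linarith)]; ring
    · rw [min_eq_right h, abs_of_nonneg (by linarith)]; ring
  have h2 : s ≤ ∑ i, min (p i) (q i) := (le_min hpk hqk).trans <|
    Finset.single_le_sum (f := fun i => min (p i) (q i))
      (fun i _ => le_min (hp i) (hq i)) (Finset.mem_univ k)
  simp only [h1, Finset.sum_sub_distrib, Finset.sum_add_distrib, hp1, hq1, ← Finset.mul_sum]
  linarith

/-- In dimension `n`, if `n + 1` points admit no nontrivial affine relation, then every vector is a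
combination of them with total weight zero. -/
theorem exists_sum_eq_zero_smul_eq {n : ℕ} {X : Type*} [AddCommGroup X] [Module ℝ X]
    [FiniteDimensional ℝ X] (hX : Module.finrank ℝ X = n) (x : Fin (n + 1) → X)
    (hx : ∀ c : Fin (n + 1) → ℝ, ∑ i, c i = 0 → ∑ i, c i • x i = 0 → c = 0) (v : X) :
    ∃ c : Fin (n + 1) → ℝ, ∑ i, c i = 0 ∧ ∑ i, c i • x i = v := by
  have key : ∀ a : Fin n → ℝ, ∑ i, (Fin.cons (-∑ j, a j) a : Fin (n + 1) → ℝ) i = 0 ∧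
      ∑ i, (Fin.cons (-∑ j, a j) a : Fin (n + 1) → ℝ) i • x i
        = ∑ i, a i • (x i.succ - x 0) := by
    intro a
    constructor
    · simp [Fin.sum_univ_succ]
    · simp [Fin.sum_univ_succ, smul_sub, Finset.sum_sub_distrib, ← Finset.sum_smul]
      abel
  have hli : LinearIndependent ℝ fun i : Fin n => x i.succ - x 0 := by
    rw [Fintype.linearIndependent_iff]
    intro a ha i
    simpa using congrFun (hx _ (key a).1 ((key a).2.trans ha)) i.succ
  have hspan := hli.span_eq_top_of_card_eq_finrank' (by simp [hX])
  obtain ⟨a, ha⟩ := (Submodule.mem_span_range_iff_exists_fun ℝ).1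
    (hspan ▸ Submodule.mem_top : v ∈ Submodule.span ℝ (Set.range fun i : Fin n => x i.succ - x 0))
  exact ⟨_, (key a).1, (key a).2.trans ha⟩

/-! ### Covers and the two cases -/

/-- A set is bounded in `betaSet` by any cover with at most `m` pieces of small diameter. -/
theorem betaSet_le_of_cover {X ι : Type*} [NormedAddCommGroup X] [Fintype ι] {A : Set X} {m : ℕ}
    (hm : Fintype.card ι ≤ m) (hA : 0 < Metric.diam A) {r : ℝ} (hr : 0 ≤ r) (S : ι → Set X)
    (hS : A ⊆ ⋃ i, S i)
    (hd : ∀ i, ∀ y ∈ A ∩ S i, ∀ z ∈ A ∩ S i, dist y z ≤ r * Metric.diam A) :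
    betaSet A m ≤ r := by
  let e : ι ↪ Fin m := (Fintype.equivFin ι).toEmbedding.trans (Fin.castLEEmb hm)
  let T : Fin m → Set X := fun k => {y ∈ A | ∃ i, e i = k ∧ y ∈ S i}
  have hT : A = ⋃ k, T k := by
    refine Set.Subset.antisymm (fun y hy => ?_) (Set.iUnion_subset fun k => Set.sep_subset _ _)
    obtain ⟨i, hi⟩ := Set.mem_iUnion.1 (hS hy)
    exact Set.mem_iUnion.2 ⟨e i, hy, i, rfl, hi⟩
  refine (csInf_le (betaSet_bddBelow A m) ⟨T, hT, rfl⟩).trans ?_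
  rw [one_div, inv_mul_eq_div, div_le_iff₀ hA]
  have h0 : 0 ≤ r * Metric.diam A := mul_nonneg hr hA.le
  refine Real.iSup_le (fun k => Metric.diam_le_of_forall_dist_le h0 ?_) h0
  rintro y ⟨hy, i, hi, hyi⟩ z ⟨hz, j, hj, hzj⟩
  obtain rfl := e.injective (hi.trans hj.symm)
  exact hd i y ⟨hy, hyi⟩ z ⟨hz, hzj⟩

/-- A set in a three-dimensional space that does not fit in a ball of radius `164 / 221` times
its diameter is close to a simplex, and splits into four pieces of smaller diameter. -/
theorem exists_cover_of_not_subset_closedBall {X : Type*} [NormedAddCommGroup X] [NormedSpace ℝ X]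
    (hX : Module.finrank ℝ X = 3) {A : Set X} {δ : ℝ} (hδ : 0 < δ)
    (hA : ∀ y ∈ A, ∀ z ∈ A, dist y z ≤ δ)
    (hball : ∀ c : X, ¬ A ⊆ Metric.closedBall c (164 / 221 * δ)) :
    ∃ S : Fin 4 → Set X, A ⊆ ⋃ k, S k ∧
      ∀ k, ∀ y ∈ A ∩ S k, ∀ z ∈ A ∩ S k, dist y z ≤ 171 / 172 * δ := by
  have : FiniteDimensional ℝ X := Module.finite_of_finrank_eq_succ hX
  have : ProperSpace X := FiniteDimensional.proper_real X
  obtain ⟨x, hxA, hx⟩ : ∃ x : Fin 4 → X, (∀ i, x i ∈ A) ∧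
      ∀ c : X, ∃ i, 164 / 221 * δ < dist (x i) c := by
    by_contra! hcon
    have hne := Convex.helly_theorem_compact' (𝕜 := ℝ)
      (F := fun a : A => Metric.closedBall (a : X) (164 / 221 * δ))
      (fun a => convex_closedBall _ _) (fun a => isCompact_closedBall _ _) ?_
    · obtain ⟨c, hc⟩ := hne
      refine hball c fun a ha => ?_
      rw [Metric.mem_closedBall, dist_comm]
      exact Set.mem_iInter.1 hc ⟨a, ha⟩
    · intro I hI
      rcases I.eq_empty_or_nonempty with rfl | hIne
      · simp
      have : Nonempty I := hIne.to_subtype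
      obtain ⟨φ, hφ⟩ : ∃ φ : Fin 4 → I, Function.Surjective φ := by
        have hcard : Fintype.card I ≤ 4 := by simpa [hX] using hI
        exact ⟨_, Function.invFun_surjective
          ((Fintype.equivFin I).toEmbedding.trans (Fin.castLEEmb hcard)).injective⟩
      obtain ⟨c, hc⟩ := hcon (fun i => ((φ i : A) : X)) fun i => (φ i : A).2
      refine ⟨c, Set.mem_iInter₂.2 fun a ha => ?_⟩
      obtain ⟨i, hi⟩ := hφ ⟨a, ha⟩
      have := hc i
      rw [hi] at this
      rwa [Metric.mem_closedBall, dist_comm]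
  obtain ⟨g, hg0, hg1, hgx⟩ := exists_dual_certificate_of_no_common_ball x (by positivity) hx
  set ρ := ∑ i, g i (x i) with hρ
  have hg0' : ∀ v, ∑ i, g i v = 0 := fun v => by simpa using DFunLike.congr_fun hg0 v
  have hle : ∀ i, ∀ y ∈ A, g i (x i - y) ≤ ‖g i‖ * δ := fun i y hy =>
    (le_abs_self _).trans <| (g i).le_opNorm_of_le (by simpa [dist_eq_norm] using hA _ (hxA i) _ hy)
  have hsum : ∀ y, ∑ i, (‖g i‖ * δ - g i (x i - y)) = δ - ρ := fun y => by
    simp [Finset.sum_sub_distrib, ← Finset.sum_mul, hg1, hg0', hρ]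
  have hself : ∀ i, ‖g i‖ * δ ≤ δ - ρ := fun i => by
    rw [← hsum (x i)]
    have := Finset.single_le_sum (f := fun j => ‖g j‖ * δ - g j (x j - x i))
      (fun j _ => sub_nonneg.2 (hle j _ (hxA i))) (Finset.mem_univ i)
    simpa using this
  -- The four norms sum to one, and the other three are bounded by `hself`.
  have hlow : ∀ i, δ - 3 * (δ - ρ) ≤ ‖g i‖ * δ := fun i => by
    have h1 : ∑ j, ‖g j‖ * δ = δ := by rw [← Finset.sum_mul, hg1, one_mul]
    rw [← Finset.add_sum_erase _ _ (Finset.mem_univ i)] at h1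
    have h2 := Finset.sum_le_card_nsmul (Finset.univ.erase i) (fun j => ‖g j‖ * δ) (δ - ρ)
      fun j _ => hself j
    simp only [Finset.card_erase_of_mem, Finset.mem_univ, Finset.card_univ, Fintype.card_fin,
      Nat.reduceSub, nsmul_eq_mul, Nat.cast_ofNat] at h2
    linarith
  have hpos : 0 < δ - ρ := by
    have := hself 0
    have := hlow 0
    linarith
  let μ : X → Fin 4 → ℝ := fun y i => (‖g i‖ * δ - g i (x i - y)) / (δ - ρ)
  have hμ0 : ∀ y ∈ A, ∀ i, 0 ≤ μ y i := fun y hy i =>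
    div_nonneg (sub_nonneg.2 (hle i y hy)) hpos.le
  have hμ1 : ∀ y, ∑ i, μ y i = 1 := fun y => by
    rw [← Finset.sum_div, hsum, div_self hpos.ne']
  -- Since `δ - ρ < 57 / 221 * δ`, the entry is at least `δ / (δ - ρ) - 3 > 221 / 57 - 3`.
  have hμd : ∀ i, 50 / 57 ≤ μ (x i) i := fun i => by
    have := hlow i
    simp only [μ, sub_self, map_zero, sub_zero]
    rw [le_div_iff₀ hpos]
    linarith
  have hcomb : ∀ (c : Fin 4 → ℝ), ∑ i, c i = 0 → ∀ j,
      ∑ i, c i * μ (x i) j = g j (∑ i, c i • x i) / (δ - ρ) := fun c hc j => by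
    have : ∀ i, c i * μ (x i) j
        = (c i * (‖g j‖ * δ - g j (x j)) + c i * g j (x i)) / (δ - ρ) := fun i => by
      simp only [μ, map_sub]; ring
    simp only [this, ← Finset.sum_div, Finset.sum_add_distrib, ← Finset.sum_mul, hc]
    simp
  have hexp : ∀ c : Fin 4 → ℝ, 43 / 57 * ∑ i, |c i| ≤ ∑ j, |∑ i, c i * μ (x i) j| := fun c => by
    have := sum_abs_le_sum_abs_vecMul (fun i j => μ (x i) j) (fun i => hμ0 _ (hxA i))
      (fun i => hμ1 _) hμd c
    norm_num at this ⊢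
    exact this
  refine ⟨fun k => {y | 1 / 4 ≤ μ y k}, fun y hy => ?_, ?_⟩
  · by_contra hcon
    simp only [Set.mem_iUnion, Set.mem_ofPred_eq, not_exists, not_le] at hcon
    have := Finset.sum_lt_sum_of_nonempty (Finset.univ_nonempty (α := Fin 4)) fun k _ => hcon k
    rw [hμ1] at this
    norm_num at this
  · rintro k y ⟨hyA, hyk⟩ z ⟨hzA, hzk⟩
    obtain ⟨c, hc0, hc⟩ := exists_sum_eq_zero_smul_eq hX x (fun c hc0 hc => by
      have h1 := hexp c
      simp only [hcomb c hc0, hc, map_zero, zero_div, abs_zero, Finset.sum_const_zero] at h1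
      have h2 : ∑ i, |c i| = 0 :=
        le_antisymm (by linarith) (Finset.sum_nonneg fun i _ => abs_nonneg _)
      funext i
      exact abs_eq_zero.1
        ((Finset.sum_eq_zero_iff_of_nonneg fun i _ => abs_nonneg (c i)).1 h2 i (Finset.mem_univ i)))
      (y - z)
    have h1 := hexp c
    have h2 : ∀ j, ∑ i, c i * μ (x i) j = μ y j - μ z j := fun j => by
      rw [hcomb c hc0, hc]
      simp only [μ, map_sub]
      ring
    simp only [h2] at h1
    have h3 := sum_abs_sub_le_of_le_apply (μ y) (μ z) (hμ0 y hyA) (hμ0 z hzA) (hμ1 y) (hμ1 z)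
      hyk hzk
    have h4 := norm_sum_smul_le_of_sum_eq_zero x (fun i j => hA _ (hxA i) _ (hxA j)) c hc0
    rw [hc, ← dist_eq_norm] at h4
    -- The factor is `1 / 2 * (57 / 43) * (3 / 2) = 171 / 172`; staying below `1` needs diagonal
    -- entries above `7 / 8`, that is `R > 23 / 31`.
    nlinarith

/-- A set inside a ball inherits the partitions of the unit ball. -/
theorem betaSet_le_of_subset_closedBall {X : Type*} [NormedAddCommGroup X] [NormedSpace ℝ X]
    {A : Set X} (hA : 0 < Metric.diam A) {m : ℕ} {c : X} {R : ℝ} (hR : 0 < R)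
    (hAc : A ⊆ Metric.closedBall c (R * Metric.diam A)) {S : Fin m → Set X}
    (hS : Metric.closedBall (0 : X) 1 = ⋃ k, S k) :
    betaSet A m ≤ R * ⨆ k, Metric.diam (S k) := by
  set t := R * Metric.diam A with ht
  have htpos : 0 < t := mul_pos hR hA
  refine betaSet_le_of_cover (by simp) hA
    (mul_nonneg hR.le (Real.iSup_nonneg fun _ => Metric.diam_nonneg))
    (fun k => {y | t⁻¹ • (y - c) ∈ S k}) (fun y hy => ?_) ?_
  · have : t⁻¹ • (y - c) ∈ Metric.closedBall (0 : X) 1 := by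
      have h := hAc hy
      rw [mem_closedBall_iff_norm] at h
      rw [mem_closedBall_zero_iff, norm_smul, norm_inv, Real.norm_of_nonneg htpos.le,
        inv_mul_eq_div]
      exact div_le_one_of_le₀ h htpos.le
    rw [hS] at this
    simpa using this
  · rintro k y ⟨-, hy⟩ z ⟨-, hz⟩
    have hb : Bornology.IsBounded (S k) :=
      (Metric.isBounded_closedBall (x := (0 : X)) (r := 1)).subset (hS ▸ Set.subset_iUnion S k)
    have h1 := (Metric.dist_le_diam_of_mem hb hy hz).trans
      (le_ciSup (Set.finite_range fun k => Metric.diam (S k)).bddAbove k)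
    rw [dist_smul₀, dist_sub_right, norm_inv, Real.norm_of_nonneg htpos.le, inv_mul_eq_div,
      div_le_iff₀ htpos] at h1
    calc dist y z ≤ _ := h1
      _ = _ := by rw [ht]; ring

/-- If the unit ball of a three-dimensional space has `betaSet` below `221 / 328` for eight pieces,
then eight pieces strictly and uniformly reduce diameters in that space. -/
theorem betaSpace_eight_lt_one {X : Type*} [NormedAddCommGroup X] [NormedSpace ℝ X]
    (hX : Module.finrank ℝ X = 3) (hβ : betaSet (Metric.closedBall (0 : X) 1) 8 < 221 / 328) :
    betaSpace X 8 < 1 := by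
  have : Nontrivial X := Module.nontrivial_of_finrank_pos (R := ℝ) (by omega)
  obtain ⟨_, ⟨S, hS, rfl⟩, hr⟩ := exists_lt_of_csInf_lt
    (by exact ⟨_, fun _ => Metric.closedBall (0 : X) 1, (Set.iUnion_const _).symm, rfl⟩) hβ
  rw [Metric.diam_closedBall_eq _ zero_le_one] at hr
  set σ := ⨆ k, Metric.diam (S k)
  have hlt : max (171 / 172) (164 / 221 * σ) < 1 := max_lt (by norm_num) (by linarith)
  refine lt_of_le_of_lt (Real.sSup_le ?_ (le_max_of_le_left (by norm_num))) hlt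
  rintro _ ⟨A, hAb, hA, rfl⟩
  by_cases hball : ∃ c, A ⊆ Metric.closedBall c (164 / 221 * Metric.diam A)
  · obtain ⟨c, hc⟩ := hball
    exact (betaSet_le_of_subset_closedBall hA (by norm_num) hc hS).trans (le_max_right _ _)
  · obtain ⟨T, hT, hTd⟩ := exists_cover_of_not_subset_closedBall hX hA
      (fun y hy z hz => Metric.dist_le_diam_of_mem hAb hy hz) (not_exists.1 hball)
    exact (betaSet_le_of_cover (by simp) hA (by norm_num) T hT hTd).trans (le_max_left _ _)

/-- The octahedron is covered by six of its translates scaled by `2 / 3`. -/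
theorem betaSet_closedBall_l1_le :
    betaSet (Metric.closedBall (0 : PiLp 1 (fun _ : Fin 3 => ℝ)) 1) 8 ≤ 2 / 3 := by
  have hdiam : Metric.diam (Metric.closedBall (0 : PiLp 1 (fun _ : Fin 3 => ℝ)) 1) = 2 := by
    rw [Metric.diam_closedBall_eq _ zero_le_one, mul_one]
  have hnorm : ∀ v : PiLp 1 (fun _ : Fin 3 => ℝ), ‖v‖ = ∑ i, |v i| := fun v => by
    simp [PiLp.norm_eq_of_L1]
  let p : Fin 3 × Bool → PiLp 1 (fun _ : Fin 3 => ℝ) := fun i =>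
    PiLp.single 1 i.1 (if i.2 then 1 / 3 else -(1 / 3))
  refine betaSet_le_of_cover (ι := Fin 3 × Bool) (by simp) (by rw [hdiam]; norm_num) (by norm_num)
    (fun i => Metric.closedBall (p i) (2 / 3)) (fun y hy => ?_) ?_
  · rw [mem_closedBall_zero_iff, hnorm] at hy
    obtain ⟨k, hk⟩ := Finite.exists_max fun i => |y i|
    -- With `a = |y k|` maximal, the other coordinates contribute at most `min (2 * a) (1 - a)`, so
    -- the distance `|a - 1 / 3|` plus this is at most `2 / 3`.
    refine Set.mem_iUnion.2 ⟨(k, decide (0 ≤ y k)), ?_⟩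
    rw [mem_closedBall_iff_norm, hnorm]
    have h1 : |y k - (if decide (0 ≤ y k) then 1 / 3 else -(1 / 3))| = |(|y k|) - 1 / 3| := by
      by_cases h : 0 ≤ y k
      · simp [h, abs_of_nonneg h]
      · rw [abs_of_neg (not_le.1 h), ← abs_neg]
        simp only [h, decide_false, Bool.false_eq_true, if_false]
        ring_nf
    have h2 : ∀ i ∈ Finset.univ.erase k, |(y - p (k, decide (0 ≤ y k))) i| = |y i| := fun i hi => by
      simp [p, Finset.ne_of_mem_erase hi]
    have h3 := Finset.sum_le_card_nsmul (Finset.univ.erase k) (fun i => |y i|) |y k| fun i _ => hk i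
    rw [← Finset.add_sum_erase _ _ (Finset.mem_univ k)] at hy ⊢
    rw [Finset.sum_congr rfl h2, show |(y - p (k, decide (0 ≤ y k))) k| = |(|y k|) - 1 / 3| by
      rw [← h1]; simp [p]]
    simp only [Finset.card_erase_of_mem, Finset.mem_univ, Finset.card_univ, Fintype.card_fin,
      Nat.reduceSub, nsmul_eq_mul, Nat.cast_ofNat] at h3
    rcases abs_cases (|y k| - 1 / 3) with ⟨h, -⟩ | ⟨h, h'⟩ <;> rw [h] <;> linarith
  · rintro i y ⟨-, hy⟩ z ⟨-, hz⟩
    rw [hdiam]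
    rw [Metric.mem_closedBall] at hy hz
    linarith [dist_triangle_right y z (p i)]

theorem mainTheorem4 :
    (∀ (X : Type*) [NormedAddCommGroup X] [NormedSpace ℝ X],
      Module.finrank ℝ X = 3 →
      betaSet (Metric.closedBall (0 : X) 1) 8 < 221 / 328 →
      betaSpace X 8 < 1) ∧
    betaSpace (PiLp 1 (fun _ : Fin 3 => ℝ)) 8 < 1 := by
  refine ⟨fun X _ _ hX hβ => betaSpace_eight_lt_one hX hβ, betaSpace_eight_lt_one (by
    rw [(WithLp.linearEquiv 1 ℝ (Fin 3 → ℝ)).finrank_eq]; simp) ?_⟩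
  exact betaSet_closedBall_l1_le.trans_lt (by norm_num)
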